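/- Let $k$ be a field of characteristic $p>0$ and let $G$ be a nontrivial finite $p$-group. Let $\mathfrak{Ts}$ be the category whose objects are the finitely generated commutative $k$-algebras $A$ with an action of $G$ by $k$-algebra automorphisms such that the trace map $A\to A^G$, $a\mapsto\sum_{g\in G}g a$, is surjective, and whose morphisms are the $G$-equivariant $k$-algebra homomorphisms. For objects $A,B$ write $A\prec B$ if there is a monomorphism $A\to B$ in $\mathfrak{Ts}$. An object $B$ is called basic if it is universal (for every object $A$ there is a morphism $B\to A$) and minimal ($A\prec B$ implies $B\prec A$). Let $d_k(G)$ denote the common Krull dimension of all basic objects of $\mathfrak{Ts}$; the equation $d_k(G)=d$ means that basic objects exist and that each of them has Krull dimension $d$. Let $V$ be any finite-dimensional faithful representation of $G$ over $k$, and let $k(V^*)$ be the field of fractions of the symmetric algebra of $V^*$, with the induced $G$-action. Let $e_k(G)$ be the essential dimension of $G$, i.e. the minimal transcendence degree over $k$ of a $G$-stable intermediate field $k\le E\le k(V^*)$ on which $G$ acts faithfully. Then, for every choice of $V$, the following are equivalent: 1. $d_k(G)=1$; 2. $e_k(G)=1$; 3. for some $n\ge 1$, $G$ is isomorphic to the additive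 group $\mathbb{F}_{p^n}^+$ of the field with $p^n$ elements, and $G$ is isomorphic to a subgroup of the additive group of $k$; 4. $G$ is isomorphic to a subgroup of $\mathrm{GL}_2(k)$. -/

import Mathlib

open CategoryTheory

universe u v

/-! ### The category of trace-surjective algebras -/

/-- An object of the category `𝔗𝔰_G`: a finitely generated commutative `k`-algebra with an action of
the finite group `G` by `k`-algebra automorphisms such that the trace `a ↦ ∑ g, g • a` maps onto the
ring of invariants. (A finitely generated `k`-algebra has an isomorphic copy in the universe
of `k`.) -/
structure TraceSurj (k : Type u) [Field k] (G : Type v) [Group G] [Fintype G] where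
  carrier : Type u
  [commRing : CommRing carrier]
  [algebra : Algebra k carrier]
  [action : MulSemiringAction G carrier]
  [smulComm : SMulCommClass G k carrier]
  finiteType : Algebra.FiniteType k carrier
  trace_surjective : ∀ b : carrier, (∀ g : G, g • b = b) → ∃ a : carrier, ∑ g : G, g • a = b

namespace TraceSurj

attribute [instance] TraceSurj.commRing TraceSurj.algebra TraceSurj.action TraceSurj.smulComm

variable {k : Type u} [Field k] {G : Type v} [Group G] [Fintype G]

instance : CoeSort (TraceSurj k G) (Type u) := ⟨TraceSurj.carrier⟩

/-- Morphisms: `G`-equivariant homomorphisms of `k`-algebras. -/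
@[ext]
structure Hom (A B : TraceSurj k G) where
  toAlgHom : A →ₐ[k] B
  map_smul : ∀ (g : G) (a : A), toAlgHom (g • a) = g • toAlgHom a

instance : Category (TraceSurj k G) where
  Hom A B := Hom A B
  id A := ⟨AlgHom.id k A, fun _ _ => rfl⟩
  comp f h := ⟨h.toAlgHom.comp f.toAlgHom, fun g a => by
    simp only [AlgHom.comp_apply, f.map_smul, h.map_smul]⟩

/-- Universal objects are the weakly initial objects of the category. -/
def IsUniversal (B : TraceSurj k G) : Prop :=
  ∀ A : TraceSurj k G, Nonempty (B ⟶ A)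

/-- `A ≺ B`: there is a monomorphism from `A` to `B` in the category. -/
def Prec (A B : TraceSurj k G) : Prop :=
  ∃ f : A ⟶ B, Mono f

/-- `B` is minimal if `A ≺ B` implies `B ≺ A`. -/
def IsMinimal (B : TraceSurj k G) : Prop :=
  ∀ A : TraceSurj k G, Prec A B → Prec B A

/-- Basic objects are the universal and minimal ones. -/
def IsBasic (B : TraceSurj k G) : Prop :=
  IsUniversal B ∧ IsMinimal B

end TraceSurj

/-- `BasicDimEq k G d` says that `d_k(G) = d`, where `d_k(G)` is the common Krull dimension of
the basic objects: basic objects exist, and every one of them has Krull dimension `d`. -/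
def BasicDimEq (k : Type u) [Field k] (G : Type v) [Group G] [Fintype G] (d : ℕ) : Prop :=
  (∃ B : TraceSurj k G, B.IsBasic) ∧
    ∀ B : TraceSurj k G, B.IsBasic → ringKrullDim B = d

/-! ### Essential dimension -/

section EssentialDimension

variable {k G V K : Type*} [Field k] [Group G] [AddCommGroup V] [Module k V]
  [Field K] [Algebra k K]

/-- `E` is a `G`-stable intermediate field on which `G` acts faithfully. -/
def IsFaithfulStable (σ : G →* (K ≃ₐ[k] K)) (E : IntermediateField k K) : Prop :=
  (∀ g : G, ∀ x ∈ E, σ g x ∈ E) ∧ ∀ g : G, (∀ x ∈ E, σ g x = x) → g = 1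

/-- `e_k(K)`: the minimal transcendence degree over `k` of an intermediate field of `K / k` that is
`G`-stable with faithful action. (The set is nonempty if `G` acts faithfully on `K`.) -/
noncomputable def fieldEssDim (σ : G →* (K ≃ₐ[k] K)) : Cardinal :=
  sInf {d | ∃ E : IntermediateField k K, IsFaithfulStable σ E ∧ d = Algebra.trdeg k E}

/-- The algebra endomorphism of `Sym(M)` induced by a linear endomorphism of `M`. -/
noncomputable def symEnd (k M : Type*) [Field k] [AddCommGroup M] [Module k M] :
    (M →ₗ[k] M) →* (SymmetricAlgebra k M →ₐ[k] SymmetricAlgebra k M) where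
  toFun f := SymmetricAlgebra.lift (SymmetricAlgebra.ι k M ∘ₗ f)
  map_one' := by
    ext x
    simp
  map_mul' f h := by
    ext x
    simp

/-- The action of `G` on `Sym(V*)` by algebra automorphisms induced by the dual representation. -/
noncomputable def symAction (ρ : Representation k G V) :
    G →* (SymmetricAlgebra k (Module.Dual k V) ≃ₐ[k] SymmetricAlgebra k (Module.Dual k V)) :=
  (AlgEquiv.algHomUnitsEquiv k (SymmetricAlgebra k (Module.Dual k V))).toMonoidHom.comp
    ((symEnd k (Module.Dual k V)).comp ρ.dual).toHomUnits

/-- The field `k(V*) = Quot(Sym(V*))`. -/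
abbrev RatFunField (k V : Type*) [Field k] [AddCommGroup V] [Module k V] : Type _ :=
  FractionRing (SymmetricAlgebra k (Module.Dual k V))

/-- The extension of an algebra automorphism of a domain to its field of fractions. -/
noncomputable def fracAut (k R : Type*) [Field k] [CommRing R] [IsDomain R] [Algebra k R] :
    (R ≃ₐ[k] R) →* (FractionRing R ≃ₐ[k] FractionRing R) where
  toFun f := IsFractionRing.algEquivOfAlgEquiv f
  map_one' := by
    ext x
    obtain ⟨a, b, hb, rfl⟩ := IsFractionRing.div_surjective (A := R) x
    simp
  map_mul' f h := by
    ext x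
    obtain ⟨a, b, hb, rfl⟩ := IsFractionRing.div_surjective (A := R) x
    simp

/-- The action of `G` on `k(V*)` induced by a representation `V`. -/
noncomputable def ratFunAction (ρ : Representation k G V) :
    G →* (RatFunField k V ≃ₐ[k] RatFunField k V) :=
  (fracAut k (SymmetricAlgebra k (Module.Dual k V))).comp (symAction ρ)

/-- The essential dimension `e_k(G)`, computed from the (faithful) representation `V` of `G`. -/
noncomputable def essDim (ρ : Representation k G V) : Cardinal :=
  fieldEssDim (K := RatFunField k V) (ratFunAction ρ)

end EssentialDimension

/-! The pivot is that a nontrivial finite `p`-group with a faithful projective representation of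
dimension two in characteristic `p` is elementary abelian and embeds into the additive group of the
field. Over a perfect field, a central element of order `p` is represented, up to a scalar, by `1`
plus a square-zero matrix. Its centralizer contains the whole representation, and modulo scalars the
invertible part of this centralizer is additive. This is `IsFaithfulProjective.elementary`. It
covers subgroups of `GL₂(k)`, because a `p`-group meets the scalars trivially there; conversely, the
additive group sits in `GL₂(k)` as unipotent matrices.

If `e_k(G) = 1`, a finitely generated stable subalgebra of the one-dimensional field already has
faithful action. It lies in a rational function field in several variables, and a Kronecker
substitution embeds it into `k(X)`. Lüroth's theorem then makes its fraction field isomorphic to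
`k(X)`, so `G` acts faithfully by Möbius transformations and the pivot applies.

If `G` embeds into the additive group of `k`, then `k[X]` with translations is trace-surjective and
universal, and its equivariant endomorphisms are injective. Hence it is basic, and every basic
object embeds into it and contains a copy of it, so has dimension one.

If a basic object has dimension one, universality maps it equivariantly into `k(V*)`. Its image
generates a stable field of transcendence degree at most one, faithful because an element of trace
one survives. Degree zero is impossible, since the constants are algebraically closed in `k(V*)`. -/

/-! ### Finite subgroups of the additive group of a field -/

section ElementaryAbelian

variable {K : Type*} [Field K] (p : ℕ) [Fact p.Prime] [CharP K p]

theorem exists_linearEquiv_pi_zmod (M : Type*) [AddCommGroup M] [Module (ZMod p) M] [Finite M] :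
    ∃ n : ℕ, Nonempty (M ≃ₗ[ZMod p] (Fin n → ZMod p)) :=
  ⟨_, ⟨(Module.finBasis (ZMod p) M).equivFun⟩⟩

/-- A nontrivial finite group that embeds into the additive group of a field of characteristic `p`
is isomorphic to a finite power of `ZMod p`. -/
theorem exists_mulEquiv_pi_zmod {G : Type*} [Group G] [Finite G] [Nontrivial G]
    (f : G →* Multiplicative K) (hf : Function.Injective f) :
    ∃ n : ℕ, 1 ≤ n ∧ Nonempty (G ≃* Multiplicative (Fin n → ZMod p)) := by
  let H : AddSubgroup K := AddSubgroup.toSubgroup.symm f.range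
  let e : G ≃* Multiplicative H := MonoidHom.ofInjective hf
  have : Finite H := Finite.of_equiv G e.toEquiv
  let : Module (ZMod p) H := AddCommGroup.zmodModule fun x => by
    ext; simp
  obtain ⟨n, hn⟩ := exists_linearEquiv_pi_zmod p H
  obtain ⟨l⟩ := hn
  have : Nontrivial H := e.symm.toEquiv.nontrivial
  refine ⟨n, Nat.one_le_iff_ne_zero.mpr ?_, ⟨e.trans l.toAddEquiv.toMultiplicative⟩⟩
  rintro rfl
  exact not_subsingleton H l.toEquiv.subsingleton

/-- The additive group of a finite field is a finite power of `ZMod p`. -/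
theorem nonempty_pi_zmod_addEquiv_galoisField (n : ℕ) (hn : 1 ≤ n) :
    Nonempty ((Fin n → ZMod p) ≃+ GaloisField p n) := by
  have h : Module.finrank (ZMod p) (Fin n → ZMod p) = Module.finrank (ZMod p) (GaloisField p n) := by
    rw [GaloisField.finrank p (by omega), Module.finrank_fin_fun]
  exact ⟨(LinearEquiv.ofFinrankEq _ _ h).toAddEquiv⟩

/-- An infinite field of characteristic `p` contains any finite power of `ZMod p`. -/
theorem exists_injective_pi_zmod [Infinite K] (n : ℕ) :
    ∃ f : (Fin n → ZMod p) →+ K, Function.Injective f := by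
  let := ZMod.algebra K p
  have hr : Cardinal.aleph0 ≤ Module.rank (ZMod p) K := by
    by_contra h
    have : Module.Finite (ZMod p) K := Module.rank_lt_aleph0_iff.mp (not_le.mp h)
    exact not_finite_iff_infinite.mpr ‹Infinite K› (Module.finite_of_finite (ZMod p))
  obtain ⟨s, hs, hli⟩ := le_rank_iff_exists_linearIndependent_finset.mp
    ((Cardinal.natCast_lt_aleph0 (n := n)).le.trans hr)
  let e : Fin n ≃ s := (finCongr hs.symm).trans s.equivFin.symm
  have hli' : LinearIndependent (ZMod p) (fun i => ((e i : s) : K)) :=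
    hli.comp e e.injective
  exact ⟨(Fintype.linearCombination (ZMod p) (fun i => ((e i : s) : K))).toAddMonoidHom,
    hli'.fintypeLinearCombination_injective⟩

end ElementaryAbelian

/-! ### Projective representations of dimension two -/

/-- A family of invertible `2 × 2` matrices that is a faithful representation up to scalars. -/
structure IsFaithfulProjective {K G : Type*} [Field K] [Group G]
    (M : G → Matrix (Fin 2) (Fin 2) K) : Prop where
  mul : ∀ g h, ∃ c : K, c ≠ 0 ∧ M g * M h = c • M (g * h)
  one : ∃ c : K, c ≠ 0 ∧ M 1 = c • 1
  faithful : ∀ g, (∃ c : K, M g = c • 1) → g = 1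

theorem Matrix.eq_smul_one_iff_fin_two {K : Type*} [Field K] (A : Matrix (Fin 2) (Fin 2) K) :
    (∃ c : K, A = c • 1) ↔ A 0 1 = 0 ∧ A 1 0 = 0 ∧ A 0 0 = A 1 1 := by
  constructor
  · rintro ⟨c, rfl⟩
    simp
  · rintro ⟨h1, h2, h3⟩
    refine ⟨A 0 0, ?_⟩
    ext i j
    fin_cases i <;> fin_cases j <;> simp [h1, h2, h3]

/-- The centralizer of a non-scalar `2 × 2` matrix `N` is spanned by `1` and `N`. -/
theorem Matrix.exists_eq_of_commute_fin_two {K : Type*} [Field K]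
    {N A : Matrix (Fin 2) (Fin 2) K} (hN : ¬ ∃ c : K, N = c • 1) (h : A * N = N * A) :
    ∃ x y : K, A = x • 1 + y • N := by
  have h00 := congrFun (congrFun h 0) 0
  have h01 := congrFun (congrFun h 0) 1
  have h10 := congrFun (congrFun h 1) 0
  simp only [Matrix.mul_apply, Fin.sum_univ_two] at h00 h01 h10
  rw [Matrix.eq_smul_one_iff_fin_two] at hN
  -- Modulo scalars a matrix is the vector of its two off-diagonal entries and its diagonal
  -- difference. Commuting means that the vectors of `A` and `N` are proportional, and `y` is read
  -- off at a nonzero entry of the latter.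
  suffices ∃ y, A 0 1 = y * N 0 1 ∧ A 1 0 = y * N 1 0 ∧ A 0 0 - A 1 1 = y * (N 0 0 - N 1 1) by
    obtain ⟨y, h1, h2, h3⟩ := this
    refine ⟨A 0 0 - y * N 0 0, y, ?_⟩
    ext i j
    fin_cases i <;> fin_cases j <;> simp [h1, h2]
    linear_combination -h3
  by_cases hb : N 0 1 = 0
  · by_cases hc : N 1 0 = 0
    · have ha : N 0 0 - N 1 1 ≠ 0 := fun ha => hN ⟨hb, hc, sub_eq_zero.mp ha⟩
      refine ⟨(A 0 0 - A 1 1) / (N 0 0 - N 1 1), ?_, ?_, by field_simp⟩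
      · rw [hb, mul_zero]
        refine (mul_eq_zero.mp ?_).resolve_right ha
        rw [hb] at h01
        linear_combination -h01
      · rw [hc, mul_zero]
        refine (mul_eq_zero.mp ?_).resolve_right ha
        rw [hc] at h10
        linear_combination h10
    · refine ⟨A 1 0 / N 1 0, ?_, by field_simp, ?_⟩
      · field_simp
        linear_combination h00
      · field_simp
        linear_combination -h10
  · refine ⟨A 0 1 / N 0 1, by field_simp, ?_, ?_⟩
    · field_simp
      linear_combination -h00
    · field_simp
      linear_combination h01

/-- Trace and determinant vanish, so this is Cayley–Hamilton. -/
theorem Matrix.sq_eq_zero_of_isNilpotent_fin_two {K : Type*} [Field K]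
    {N : Matrix (Fin 2) (Fin 2) K} (h : IsNilpotent N) : N * N = 0 := by
  have ht : N 0 0 + N 1 1 = 0 := by
    simpa [Matrix.trace_fin_two] using (Matrix.isNilpotent_trace_of_isNilpotent h).eq_zero
  have hd : N 0 0 * N 1 1 - N 0 1 * N 1 0 = 0 := by
    rw [← Matrix.det_fin_two]
    obtain ⟨n, hn⟩ := h
    by_contra h0
    have h1 := congrArg Matrix.det hn
    rw [Matrix.det_pow] at h1
    rcases Nat.eq_zero_or_pos n with rfl | hpos
    · simp at hn
    · rw [Matrix.det_zero] at h1
      exact h0 (pow_eq_zero_iff hpos.ne' |>.mp h1)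
  ext i j
  fin_cases i <;> fin_cases j <;> simp [Matrix.mul_apply]
  · linear_combination (N 0 0) * ht - hd
  · linear_combination (N 0 1) * ht
  · linear_combination (N 1 0) * ht
  · linear_combination (N 1 1) * ht - hd

namespace IsFaithfulProjective

variable {K G : Type*} [Field K] [Group G] {M : G → Matrix (Fin 2) (Fin 2) K}

theorem ne_zero (hM : IsFaithfulProjective M) (g : G) : M g ≠ 0 := by
  intro h
  obtain ⟨c, hc, e⟩ := hM.mul g g⁻¹
  obtain ⟨d, hd, e'⟩ := hM.one
  rw [h, zero_mul, mul_inv_cancel, e', smul_smul] at e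
  have := congrFun (congrFun e 0) 0
  simp [hc, hd] at this

theorem exists_pow_eq (hM : IsFaithfulProjective M) (g : G) (n : ℕ) :
    ∃ c : K, c ≠ 0 ∧ M g ^ n = c • M (g ^ n) := by
  induction n with
  | zero =>
    obtain ⟨d, hd, e⟩ := hM.one
    refine ⟨d⁻¹, inv_ne_zero hd, ?_⟩
    rw [pow_zero, pow_zero, e, smul_smul, inv_mul_cancel₀ hd, one_smul]
  | succ n ih =>
    obtain ⟨c, hc, e⟩ := ih
    obtain ⟨d, hd, e'⟩ := hM.mul (g ^ n) g
    refine ⟨c * d, mul_ne_zero hc hd, ?_⟩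
    rw [pow_succ, e, smul_mul_assoc, e', smul_smul, pow_succ]

theorem map {L : Type*} [Field L] (hM : IsFaithfulProjective M) (f : K →+* L) :
    IsFaithfulProjective fun g => (M g).map f where
  mul g h := by
    obtain ⟨c, hc, e⟩ := hM.mul g h
    refine ⟨f c, (map_ne_zero f).mpr hc, ?_⟩
    rw [← Matrix.map_mul, e]
    ext i j
    simp
  one := by
    obtain ⟨c, hc, e⟩ := hM.one
    refine ⟨f c, (map_ne_zero f).mpr hc, ?_⟩
    rw [e]
    ext i j
    fin_cases i <;> fin_cases j <;> simp
  faithful g h := by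
    refine hM.faithful g ?_
    rw [Matrix.eq_smul_one_iff_fin_two] at h ⊢
    simpa [f.injective.eq_iff] using h

/-- A finite `p`-group with a faithful projective representation of dimension two over a perfect
field of characteristic `p` embeds into the additive group of the field. -/
theorem exists_injective (hM : IsFaithfulProjective M) (p : ℕ) [Fact p.Prime] [CharP K p]
    [PerfectField K] [Finite G] [Nontrivial G] (hG : IsPGroup p G) :
    ∃ f : G →* Multiplicative K, Function.Injective f := by
  have hp : p.Prime := Fact.out
  have : ExpChar K p := ExpChar.prime hp
  have : PerfectRing K p := PerfectField.toPerfectRing p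
  have : Nontrivial (Subgroup.center G) := hG.center_nontrivial
  have hdvd : p ∣ Nat.card (Subgroup.center G) := by
    obtain ⟨n, hn0, hn⟩ := (hG.to_subgroup (Subgroup.center G)).nontrivial_iff_card.mp this
    rw [hn]
    exact dvd_pow_self p hn0.ne'
  obtain ⟨⟨z, hz⟩, hz'⟩ := exists_prime_orderOf_dvd_card' p hdvd
  rw [Subgroup.orderOf_mk] at hz'
  have hz1 : z ≠ 1 := by
    rintro rfl
    rw [orderOf_one] at hz'
    exact hp.one_lt.ne hz'
  obtain ⟨c, hc, hzp⟩ : ∃ c : K, c ≠ 0 ∧ M z ^ p = c • 1 := by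
    obtain ⟨c, hc, e⟩ := hM.exists_pow_eq z p
    obtain ⟨d, hd, e'⟩ := hM.one
    refine ⟨c * d, mul_ne_zero hc hd, ?_⟩
    rw [e, ← hz', pow_orderOf_eq_one, e', smul_smul]
  have hcomm : ∀ g, M g * M z = M z * M g := by
    intro g
    obtain ⟨a, ha, e⟩ := hM.mul g z
    obtain ⟨b, hb, e'⟩ := hM.mul z g
    obtain ⟨t, ht⟩ : ∃ t : K, M g * M z = t • (M z * M g) := by
      refine ⟨a * b⁻¹, ?_⟩
      rw [e, e', smul_smul, mul_assoc, inv_mul_cancel₀ hb, mul_one,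
        (Subgroup.mem_center_iff.mp hz g)]
    have hpow : ∀ n : ℕ, M g * M z ^ n = t ^ n • (M z ^ n * M g) := by
      intro n
      induction n with
      | zero => simp
      | succ n ih =>
        rw [pow_succ, ← mul_assoc, ih, smul_mul_assoc, mul_assoc, ht, mul_smul_comm, smul_smul,
          pow_succ, mul_assoc]
    -- The commutator scalar `t` is a `p`-th root of unity because `M z ^ p` is scalar; in
    -- characteristic `p` this forces `t = 1`.
    have h1 : t ^ p = 1 := by
      have h2 := hpow p
      rw [hzp] at h2
      simp only [mul_smul_comm, mul_one, smul_mul_assoc, one_mul, smul_smul] at h2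
      have h3 : (c - t ^ p * c) • M g = 0 := by rw [sub_smul, h2, sub_self]
      have h4 := (smul_eq_zero.mp h3).resolve_right (hM.ne_zero g)
      have h5 : (1 - t ^ p) * c = 0 := by linear_combination h4
      exact (sub_eq_zero.mp ((mul_eq_zero.mp h5).resolve_right hc)).symm
    have h2 : t = 1 := by
      have : (t - 1) ^ p = 0 := by rw [sub_pow_char, h1, one_pow, sub_self]
      exact sub_eq_zero.mp (pow_eq_zero_iff hp.ne_zero |>.mp this)
    rw [ht, h2, one_smul]
  -- Perfectness is needed only here: the `p`-th root `d` makes `(M z - d) ^ p = 0`.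
  obtain ⟨d, rfl⟩ : ∃ d : K, d ^ p = c := surjective_frobenius K p c
  let N := M z - d • (1 : Matrix (Fin 2) (Fin 2) K)
  have hN : ¬ ∃ c : K, N = c • 1 := by
    rintro ⟨c, e⟩
    refine hz1 (hM.faithful z ⟨c + d, ?_⟩)
    rw [add_smul, ← e, sub_add_cancel]
  have hNN : N * N = 0 := by
    apply Matrix.sq_eq_zero_of_isNilpotent_fin_two
    refine ⟨p, ?_⟩
    have : Commute (M z) (d • (1 : Matrix (Fin 2) (Fin 2) K)) := (Commute.one_right _).smul_right d
    rw [sub_pow_char_of_commute p this, hzp, smul_pow, one_pow, sub_self]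
  have hcN : ∀ g, M g * N = N * M g := by
    intro g
    rw [mul_sub, sub_mul, hcomm, mul_smul_comm, smul_mul_assoc, mul_one, one_mul]
  choose x y hxy using fun g => Matrix.exists_eq_of_commute_fin_two hN (hcN g)
  have hli : ∀ a b a' b' : K, a • 1 + b • N = a' • 1 + b' • N → a = a' ∧ b = b' := by
    intro a b a' b' h
    have hb : b = b' := by
      by_contra hb
      have hb' : b - b' ≠ 0 := sub_ne_zero.mpr hb
      refine hN ⟨(b - b')⁻¹ * (a' - a), ?_⟩
      rw [mul_smul, eq_inv_smul_iff₀ hb', sub_smul, sub_smul, sub_eq_sub_iff_add_eq_add, add_comm, h,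
        add_comm]
    subst hb
    have h1 : (a - a') • (1 : Matrix (Fin 2) (Fin 2) K) = 0 := by
      rw [sub_smul, add_right_cancel h, sub_self]
    exact ⟨sub_eq_zero.mp ((smul_eq_zero.mp h1).resolve_right one_ne_zero), rfl⟩
  have hmul : ∀ g h, ∃ c : K, c ≠ 0 ∧ x g * x h = c * x (g * h) ∧
      x g * y h + y g * x h = c * y (g * h) := by
    intro g h
    obtain ⟨c, hc, e⟩ := hM.mul g h
    refine ⟨c, hc, hli _ _ _ _ ?_⟩
    rw [mul_smul c, mul_smul c, ← smul_add, ← hxy, ← e, hxy g, hxy h]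
    simp only [add_mul, mul_add, smul_mul_assoc, mul_smul_comm, one_mul, mul_one, hNN, smul_zero,
      add_zero]
    module
  have hx : ∀ g, x g ≠ 0 := by
    intro g h0
    obtain ⟨c, hc, h1, -⟩ := hmul g g⁻¹
    obtain ⟨d, hd, e⟩ := hM.one
    have h2 := hli (x 1) (y 1) d 0 (by rw [← hxy, e, zero_smul, add_zero])
    rw [mul_inv_cancel, h2.1, h0, zero_mul] at h1
    exact mul_ne_zero hc hd h1.symm
  -- Since `N * N = 0`, the product of `x + y N` and `x' + y' N` is `x x' + (x y' + y x') N`. The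
  -- ratio `y / x` is therefore additive and blind to the scalars `c`.
  let f : G →* Multiplicative K := MonoidHom.mk' (fun g => Multiplicative.ofAdd (y g / x g)) (by
    intro g h
    rw [← ofAdd_add]
    congr 1
    obtain ⟨c, hc, h1, h2⟩ := hmul g h
    rw [div_add_div _ _ (hx g) (hx h), h1, add_comm, h2, mul_div_mul_left _ _ hc])
  refine ⟨f, (injective_iff_map_eq_one f).mpr fun g hg => hM.faithful g ⟨x g, ?_⟩⟩
  have hy : y g = 0 := by
    have : y g / x g = 0 := hg
    exact (div_eq_zero_iff.mp this).resolve_right (hx g)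
  rw [hxy g, hy, zero_smul, add_zero]

/-- A nontrivial finite `p`-group with a faithful projective representation of dimension two over a
field of characteristic `p` is elementary abelian and embeds into the additive group. -/
theorem elementary (hM : IsFaithfulProjective M) (p : ℕ) [Fact p.Prime] [CharP K p]
    [Finite G] [Nontrivial G] (hG : IsPGroup p G) :
    ∃ n : ℕ, 1 ≤ n ∧ Nonempty (G ≃* Multiplicative (GaloisField p n)) ∧
        ∃ H : AddSubgroup K, Nonempty (G ≃* Multiplicative H) := by
  suffices (∃ n : ℕ, 1 ≤ n ∧ Nonempty (G ≃* Multiplicative (Fin n → ZMod p))) ∧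
      ∃ f : G →* Multiplicative K, Function.Injective f by
    obtain ⟨⟨n, hn, ⟨e⟩⟩, f, hf⟩ := this
    obtain ⟨l⟩ := nonempty_pi_zmod_addEquiv_galoisField p n hn
    exact ⟨n, hn, ⟨e.trans l.toMultiplicative⟩,
      AddSubgroup.toSubgroup.symm f.range, ⟨MonoidHom.ofInjective hf⟩⟩
  -- A finite field is perfect. Over an infinite field the algebraic closure only yields the
  -- isomorphism type of `G`, but that suffices, as `K` contains every finite elementary abelian
  -- `p`-group.
  rcases finite_or_infinite K with hK | hK
  · obtain ⟨f, hf⟩ := hM.exists_injective p hG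
    exact ⟨exists_mulEquiv_pi_zmod p f hf, f, hf⟩
  · have : CharP (AlgebraicClosure K) p := charP_of_injective_algebraMap
      (algebraMap K (AlgebraicClosure K)).injective p
    obtain ⟨f, hf⟩ := (hM.map (algebraMap K (AlgebraicClosure K))).exists_injective p hG
    obtain ⟨n, hn, ⟨e⟩⟩ := exists_mulEquiv_pi_zmod p f hf
    obtain ⟨i, hi⟩ := exists_injective_pi_zmod (K := K) p n
    exact ⟨⟨n, hn, ⟨e⟩⟩, (AddMonoidHom.toMultiplicative i).comp e.toMonoidHom,
      hi.comp e.injective⟩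

end IsFaithfulProjective

/-- A finite `p`-group of invertible `2 × 2` matrices in characteristic `p` contains no nontrivial
scalar matrices. -/
theorem isFaithfulProjective_of_mulEquiv {K G : Type*} [Field K] [Group G] (p : ℕ) [Fact p.Prime]
    [CharP K p] (hG : IsPGroup p G) (f : G →* GL (Fin 2) K) (hf : Function.Injective f) :
    IsFaithfulProjective fun g => (f g : Matrix (Fin 2) (Fin 2) K) where
  mul g h := ⟨1, one_ne_zero, by simp⟩
  one := ⟨1, one_ne_zero, by simp⟩
  faithful g := by
    rintro ⟨c, hc⟩
    obtain ⟨n, hn⟩ := hG g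
    have h1 : (c • (1 : Matrix (Fin 2) (Fin 2) K)) ^ p ^ n = 1 := by
      rw [← hc, ← Units.val_pow_eq_pow_val, ← map_pow, hn, map_one, Units.val_one]
    rw [smul_pow, one_pow] at h1
    have h2 : c ^ p ^ n = 1 := by simpa using congrFun (congrFun h1 0) 0
    have h3 : (c - 1) ^ p ^ n = 0 := by rw [sub_pow_char_pow, h2, one_pow, sub_self]
    have h4 : c = 1 := sub_eq_zero.mp (eq_zero_of_pow_eq_zero h3)
    apply hf
    rw [map_one]
    ext1
    rw [hc, h4, one_smul, Units.val_one]

theorem exists_subgroup_GL_of_addSubgroup {K G : Type*} [Field K] [Group G]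
    (H : AddSubgroup K) (e : G ≃* Multiplicative H) :
    ∃ H : Subgroup (GL (Fin 2) K), Nonempty (G ≃* H) := by
  let f : G →* GL (Fin 2) K :=
    (Matrix.GeneralLinearGroup.upperRightHom (R := K)).toMonoidHom.comp
      ((AddMonoidHom.toMultiplicative H.subtype).comp e.toMonoidHom)
  have hf : Function.Injective f :=
    Matrix.GeneralLinearGroup.injective_upperRightHom.comp
      (Subtype.val_injective.comp e.injective)
  exact ⟨f.range, ⟨MonoidHom.ofInjective hf⟩⟩

/-! ### Specializing rational functions to one variable -/

section Kronecker

open Polynomial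

variable {k : Type*} [Field k]

/-- Kronecker substitution: a polynomial with exponents in a fixed finite set is determined by
its image under `X i ↦ X ^ N ^ i` if `N` is large. -/
theorem MvPolynomial.exists_algHom_polynomial_eq_zero_imp {m : ℕ} (E : Finset (Fin m →₀ ℕ)) :
    ∃ κ : MvPolynomial (Fin m) k →ₐ[k] k[X], ∀ q, q.support ⊆ E → κ q = 0 → q = 0 := by
  obtain ⟨N, hN⟩ : ∃ N : ℕ, ∀ s ∈ E, ∀ i, s i < N := by
    refine ⟨E.sup (fun s => Finset.univ.sup fun i => s i) + 1, fun s hs i => Nat.lt_succ_of_le ?_⟩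
    exact (Finset.le_sup (f := fun i => s i) (Finset.mem_univ i)).trans
      (Finset.le_sup (f := fun s : Fin m →₀ ℕ => Finset.univ.sup fun i => s i) hs)
  -- The `s i` are the base-`N` digits of `w s`, so distinct exponents in `E` go to distinct powers
  -- of `X` and nothing cancels.
  let w : (Fin m →₀ ℕ) → ℕ := fun s => ∑ i, s i * N ^ (i : ℕ)
  have hw : Set.InjOn w E := by
    intro s hs t ht h
    have h' : finFunctionFinEquiv (fun i => ⟨s i, hN s hs i⟩ : Fin m → Fin N) =
        finFunctionFinEquiv (fun i => ⟨t i, hN t ht i⟩) := by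
      ext
      simpa only [finFunctionFinEquiv_apply] using h
    ext i
    exact Fin.mk.inj_iff.mp (congrFun (finFunctionFinEquiv.injective h') i)
  let κ : MvPolynomial (Fin m) k →ₐ[k] k[X] := MvPolynomial.aeval fun i => Polynomial.X ^ N ^ (i : ℕ)
  have hκ : ∀ q, κ q = ∑ s ∈ q.support, Polynomial.monomial (w s) (q.coeff s) := by
    intro q
    conv_lhs => rw [q.as_sum, map_sum]
    refine Finset.sum_congr rfl fun s _ => ?_
    rw [MvPolynomial.aeval_monomial, Finsupp.prod_fintype _ _ (by simp), Polynomial.algebraMap_eq,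
      ← Polynomial.C_mul_X_pow_eq_monomial]
    congr 1
    simp_rw [w, ← pow_mul, Finset.prod_pow_eq_pow_sum, mul_comm]
  refine ⟨κ, fun q hq h0 => ?_⟩
  ext s
  by_contra hs
  have hs' : s ∈ q.support := by simpa using hs
  have h1 := congrArg (fun r => Polynomial.coeff r (w s)) h0
  simp only [hκ, Polynomial.finsetSum_coeff, Polynomial.coeff_monomial, Polynomial.coeff_zero] at h1
  rw [Finset.sum_eq_single_of_mem s hs', if_pos rfl] at h1
  · exact hs (by simpa using h1)
  · intro t ht hts
    exact if_neg fun h => hts (hw (hq ht) (hq hs') h)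

theorem AlgEquiv.exists_algHom_polynomial_eq_zero_imp {A : Type*} [CommRing A] [Algebra k A] {m : ℕ}
    (e : A ≃ₐ[k] MvPolynomial (Fin m) k) (F : Finset A) :
    ∃ κ : A →ₐ[k] k[X], ∀ q ∈ Submodule.span k (F : Set A), κ q = 0 → q = 0 := by
  classical
  obtain ⟨κ, hκ⟩ := MvPolynomial.exists_algHom_polynomial_eq_zero_imp (k := k)
    (F.biUnion fun a => (e a).support)
  refine ⟨κ.comp e.toAlgHom, fun q hq h => (map_eq_zero_iff e e.injective).mp (hκ (e q) ?_ h)⟩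
  clear h
  induction hq using Submodule.span_induction with
  | mem a ha => exact Finset.subset_biUnion_of_mem (fun a => (e a).support) ha
  | zero => simp
  | add a b _ _ ha hb =>
    rw [map_add]
    exact MvPolynomial.support_add.trans (Finset.union_subset ha hb)
  | smul c a _ ha =>
    rw [map_smul e]
    exact MvPolynomial.support_smul.trans ha

variable {A L : Type*} [CommRing A] [IsDomain A] [Algebra k A] [Field L] [Algebra k L] [Algebra A L]
  [IsScalarTower k A L] [IsFractionRing A L]

/-- A nonconstant rational function stays transcendental under a suitable specialization of a
finitely generated algebra of rational functions to one variable. -/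
theorem AlgEquiv.exists_algHom_ratFunc_transcendental {m : ℕ}
    (e : A ≃ₐ[k] MvPolynomial (Fin m) k) {R : Subalgebra k L} (hR : R.FG) (f : R)
    (hf : (f : L) ∉ Set.range (algebraMap k L)) :
    ∃ ψ : R →ₐ[k] RatFunc k, Transcendental k (ψ f) := by
  classical
  obtain ⟨T, rfl⟩ := hR
  obtain ⟨a, b, hb, hab⟩ := IsFractionRing.div_surjective (A := A) (f : L)
  obtain ⟨⟨h, hh⟩, hT⟩ := IsLocalization.exist_integer_multiples_of_finset (nonZeroDivisors A) T
  -- Faithfulness on the span of `a`, `b`, `h` keeps the denominators `b` and `h` nonzero, and also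
  -- every nonzero `a - c • b`, so `a / b` cannot become a constant `c`.
  obtain ⟨κ, hκ⟩ := e.exists_algHom_polynomial_eq_zero_imp {a, b, h}
  have hsub : ∀ x ∈ ({a, b, h} : Finset A), x ∈ Submodule.span k (({a, b, h} : Finset A) : Set A) :=
    fun x hx => Submodule.subset_span hx
  have hinj : Function.Injective (algebraMap k[X] (RatFunc k)) :=
    IsFractionRing.injective k[X] (RatFunc k)
  let κ' : A →ₐ[k] RatFunc k := (IsScalarTower.toAlgHom k k[X] (RatFunc k)).comp κ
  have hκ' : ∀ x, κ' x = algebraMap k[X] (RatFunc k) (κ x) := fun _ => rfl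
  let S : Submonoid A := (nonZeroDivisors k[X]).comap κ
  have hS : S ≤ nonZeroDivisors A := fun x hx => by
    rw [mem_nonZeroDivisors_iff_ne_zero]
    rintro rfl
    exact nonZeroDivisors.ne_zero (Submonoid.mem_comap.mp hx) (map_zero κ)
  have hmem : ∀ x ∈ ({a, b, h} : Finset A), x ≠ 0 → x ∈ S := fun x hx h0 =>
    mem_nonZeroDivisors_of_ne_zero fun h1 => h0 (hκ x (hsub x hx) h1)
  have hbS : b ∈ S := hmem b (by simp) (nonZeroDivisors.ne_zero hb)
  have hhS : h ∈ S := hmem h (by simp) (nonZeroDivisors.ne_zero hh)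
  let B := Localization.subalgebra.ofField L S hS
  let Φ : B →ₐ[k] RatFunc k := IsLocalization.liftAlgHom (M := S) (f := κ') (by
    rintro ⟨y, hy⟩
    rw [isUnit_iff_ne_zero, hκ', Ne, map_eq_zero_iff _ hinj]
    exact nonZeroDivisors.ne_zero (Submonoid.mem_comap.mp hy))
  have hΦ : ∀ x : A, Φ (algebraMap A B x) = κ' x := fun x => IsLocalization.lift_eq _ x
  have hRB : Algebra.adjoin k (T : Set L) ≤ B.restrictScalars k := by
    rw [Algebra.adjoin_le_iff]
    intro t ht
    obtain ⟨c, hc⟩ := hT t ht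
    change t ∈ {x | ∃ (a s : A) (_ : s ∈ S), x = algebraMap A L a * (algebraMap A L s)⁻¹}
    refine ⟨c, h, hhS, ?_⟩
    have h0 : algebraMap A L h ≠ 0 := (map_ne_zero_iff _ (IsFractionRing.injective A L)).mpr
      (nonZeroDivisors.ne_zero hh)
    rw [hc, Algebra.smul_def]
    field_simp
  let ι : Algebra.adjoin k (T : Set L) →ₐ[k] B := Subalgebra.inclusion hRB
  refine ⟨Φ.comp ι, RatFunc.transcendental_of_ne_C _ ?_⟩
  rintro ⟨c, hc⟩
  have hb0 : algebraMap A L b ≠ 0 := (map_ne_zero_iff _ (IsFractionRing.injective A L)).mpr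
      (nonZeroDivisors.ne_zero hb)
  have h1 : ι f * algebraMap A B b = algebraMap A B a := by
    apply Subtype.ext
    change (f : L) * algebraMap A L b = algebraMap A L a
    rw [← hab]
    field_simp
  have h2 := congrArg Φ h1
  rw [map_mul, hΦ, hΦ, ← AlgHom.comp_apply, hc, hκ', hκ'] at h2
  have h3 : κ (a - c • b) = 0 := by
    apply hinj
    rw [map_sub, map_smul, map_sub, ← h2, Polynomial.smul_eq_C_mul, map_mul, map_zero]
    simp
  have h4 := hκ _ (sub_mem (hsub a (by simp)) (Submodule.smul_mem _ c (hsub b (by simp)))) h3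
  refine hf ⟨c, ?_⟩
  rw [← hab, sub_eq_zero.mp h4, Algebra.smul_def, map_mul, ← IsScalarTower.algebraMap_apply]
  field_simp

/-- The constants are algebraically closed in a field of rational functions. -/
theorem AlgEquiv.mem_range_algebraMap_of_isAlgebraic {m : ℕ}
    (e : A ≃ₐ[k] MvPolynomial (Fin m) k) (f : L) (hf : IsAlgebraic k f) :
    f ∈ Set.range (algebraMap k L) := by
  by_contra h
  have hfg : (Algebra.adjoin k {f}).FG := ⟨{f}, by simp⟩
  obtain ⟨ψ, hψ⟩ := e.exists_algHom_ratFunc_transcendental hfg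
    ⟨f, Algebra.self_mem_adjoin_singleton k f⟩ h
  refine hψ (IsAlgebraic.algHom ψ ?_)
  exact (isAlgebraic_algHom_iff (Algebra.adjoin k {f}).val Subtype.val_injective).mp hf

/-- If `R` has transcendence degree at most one, then an algebra homomorphism that keeps one element
transcendental is injective. -/
theorem AlgHom.injective_of_trdeg_le_one {R S : Type*} [CommRing R] [IsDomain R] [Algebra k R]
    [CommRing S] [IsDomain S] [Algebra k S] (hR : Algebra.trdeg k R ≤ 1) (ψ : R →ₐ[k] S) (f : R)
    (hf : Transcendental k (ψ f)) : Function.Injective ψ := by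
  have hf' : Transcendental k f := fun h => hf (h.algHom ψ)
  have hind : AlgebraicIndependent k (fun _ : Unit => f) := algebraicIndependent_unique_type_iff.mpr hf'
  have hfin : Algebra.trdeg k R < Cardinal.aleph0 := hR.trans_lt Cardinal.one_lt_aleph0
  have htb : IsTranscendenceBasis k (fun _ : Unit => f) :=
    hind.isTranscendenceBasis_of_lift_trdeg_le hfin (by simpa using hR)
  have halg := htb.isAlgebraic
  rw [Set.range_const] at halg
  rw [injective_iff_map_eq_zero]
  intro x hx
  by_contra hx0
  -- A nonzero ideal containing an element algebraic over `k[f]` meets `k[f]`, which would give a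
  -- polynomial relation for `ψ f`.
  have hne := Ideal.comap_ne_bot_of_algebraic_mem (I := RingHom.ker ψ) hx0 hx (halg.isAlgebraic x)
  obtain ⟨⟨y, hy⟩, hy1, hy0⟩ := Submodule.exists_mem_ne_zero_of_ne_bot hne
  obtain ⟨P, rfl⟩ := (Algebra.adjoin_singleton_eq_range_aeval k f ▸ hy :
    y ∈ (Polynomial.aeval f).range)
  refine hf ⟨P, ?_, ?_⟩
  · rintro rfl
    exact hy0 (Subtype.ext (map_zero _))
  · rw [Polynomial.aeval_algHom_apply]
    exact hy1

/-- Lüroth's theorem for domains that embed into `k(X)`. -/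
theorem nonempty_fractionRing_algEquiv_ratFunc {R : Type*} [CommRing R] [IsDomain R] [Algebra k R]
    (ψ : R →ₐ[k] RatFunc k) (hψ : Function.Injective ψ) (f : R) (hf : Transcendental k (ψ f)) :
    Nonempty (FractionRing R ≃ₐ[k] RatFunc k) := by
  let Ψ : FractionRing R →ₐ[k] RatFunc k := IsFractionRing.liftAlgHom (g := ψ) hψ
  have hne : Ψ.fieldRange ≠ ⊥ := by
    intro h
    have h1 : ψ f ∈ Ψ.fieldRange := ⟨algebraMap R _ f, IsFractionRing.lift_algebraMap hψ f⟩
    rw [h, IntermediateField.mem_bot] at h1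
    obtain ⟨c, hc⟩ := h1
    exact hf (hc ▸ isAlgebraic_algebraMap c)
  exact ⟨(AlgEquiv.ofInjectiveField Ψ).trans (RatFunc.Luroth.algEquiv hne).symm⟩

end Kronecker

/-! ### Automorphisms of the field of rational functions in one variable -/

section Mobius

variable {k F : Type*} [Field k] [Field F] [Algebra k F]

/-- `y` is the image of `x` under the Möbius transformation with matrix `M`. -/
def IsMobius (M : Matrix (Fin 2) (Fin 2) k) (x y : F) : Prop :=
  algebraMap k F (M 1 0) * x + algebraMap k F (M 1 1) ≠ 0 ∧
    algebraMap k F (M 0 0) * x + algebraMap k F (M 0 1) =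
      y * (algebraMap k F (M 1 0) * x + algebraMap k F (M 1 1))

namespace IsMobius

variable {M N : Matrix (Fin 2) (Fin 2) k} {x y z : F}

theorem one (x : F) : IsMobius (1 : Matrix (Fin 2) (Fin 2) k) x x := by
  simp [IsMobius]

theorem comp (hN : IsMobius N y z) (hM : IsMobius M x y) : IsMobius (N * M) x z := by
  obtain ⟨h1, h2⟩ := hM
  obtain ⟨h3, h4⟩ := hN
  have hi : ∀ i, algebraMap k F ((N * M) i 0) * x + algebraMap k F ((N * M) i 1) =
      (algebraMap k F (N i 0) * y + algebraMap k F (N i 1)) *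
        (algebraMap k F (M 1 0) * x + algebraMap k F (M 1 1)) := by
    intro i
    simp only [Matrix.mul_apply, Fin.sum_univ_two, map_add, map_mul]
    linear_combination (algebraMap k F (N i 0)) * h2
  refine ⟨?_, ?_⟩
  · rw [hi]
    exact mul_ne_zero h3 h1
  · rw [hi, hi, h4, mul_assoc]

theorem map (hM : IsMobius M x y) (τ : F ≃ₐ[k] F) : IsMobius M (τ x) (τ y) := by
  obtain ⟨h1, h2⟩ := hM
  refine ⟨fun h => h1 (τ.injective ?_), ?_⟩
  · simpa using h
  · simpa using congrArg τ h2

theorem eq_of_smul_one {c : k} (h : IsMobius (c • (1 : Matrix (Fin 2) (Fin 2) k)) x y) : y = x := by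
  obtain ⟨h1, h2⟩ := h
  simp only [Matrix.smul_apply, Matrix.one_apply_eq, smul_eq_mul, mul_one, ne_eq, zero_ne_one,
    not_false_eq_true, one_ne_zero, Matrix.one_apply_ne, mul_zero, map_zero, zero_mul, zero_add,
    add_zero] at h1 h2
  exact (mul_right_cancel₀ h1 (by rw [← h2, mul_comm])).symm

theorem _root_.Transcendental.coeff_eq_zero_of_quadratic (hx : Transcendental k x) {a b c : k}
    (h : algebraMap k F a * x ^ 2 + algebraMap k F b * x + algebraMap k F c = 0) :
    a = 0 ∧ b = 0 ∧ c = 0 := by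
  have h1 : Polynomial.C a * Polynomial.X ^ 2 + Polynomial.C b * Polynomial.X + Polynomial.C c = 0 :=
    (transcendental_iff.mp hx) _ (by simpa using h)
  refine ⟨?_, ?_, ?_⟩
  · simpa [Polynomial.coeff_X, Polynomial.coeff_C] using congrArg (Polynomial.coeff · 2) h1
  · simpa [Polynomial.coeff_X, Polynomial.coeff_C] using congrArg (Polynomial.coeff · 1) h1
  · simpa [Polynomial.coeff_X, Polynomial.coeff_C] using congrArg (Polynomial.coeff · 0) h1

/-- A singular matrix would give linear relations over `k` for the transcendental `y`, which kill
the whole bottom row. -/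
theorem det_ne_zero (h : IsMobius M x y) (hy : Transcendental k y) : M.det ≠ 0 := by
  intro hd
  obtain ⟨h1, h2⟩ := h
  rw [Matrix.det_fin_two] at hd
  have hd' := congrArg (algebraMap k F) hd
  simp only [map_sub, map_mul, map_zero] at hd'
  have e1 : algebraMap k F (-M 1 0) * y + algebraMap k F (M 0 0) = 0 := by
    refine (mul_eq_zero.mp ?_).resolve_right h1
    rw [map_neg]
    linear_combination hd' + (algebraMap k F (M 1 0)) * h2
  have e2 : algebraMap k F (-M 1 1) * y + algebraMap k F (M 0 1) = 0 := by
    refine (mul_eq_zero.mp ?_).resolve_right h1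
    rw [map_neg]
    linear_combination (-x) * hd' + (algebraMap k F (M 1 1)) * h2
  have f1 := (hy.coeff_eq_zero_of_quadratic (a := 0) (b := -M 1 0) (c := M 0 0) (by simpa using e1)).2.1
  have f2 := (hy.coeff_eq_zero_of_quadratic (a := 0) (b := -M 1 1) (c := M 0 1) (by simpa using e2)).2.1
  rw [neg_eq_zero] at f1 f2
  exact h1 (by simp [f1, f2])

theorem exists_eq_smul (hM : IsMobius M x y) (hN : IsMobius N x y) (hx : Transcendental k x)
    (hy : Transcendental k y) : ∃ c : k, c ≠ 0 ∧ M = c • N := by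
  have hd := hN.det_ne_zero hy
  obtain ⟨h1, h2⟩ := hM
  obtain ⟨h3, h4⟩ := hN
  -- Equating the two fractions gives a quadratic in `x`. The vanishing of its coefficients says
  -- that `adj(N) * M` is scalar; the factor in `key` is its upper left entry over `det N`.
  obtain ⟨e2, e1, e0⟩ := hx.coeff_eq_zero_of_quadratic
    (a := M 0 0 * N 1 0 - N 0 0 * M 1 0)
    (b := M 0 0 * N 1 1 + M 0 1 * N 1 0 - N 0 0 * M 1 1 - N 0 1 * M 1 0)
    (c := M 0 1 * N 1 1 - N 0 1 * M 1 1) (by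
      simp only [map_sub, map_add, map_mul]
      linear_combination (algebraMap k F (N 1 0) * x + algebraMap k F (N 1 1)) * h2 -
        (algebraMap k F (M 1 0) * x + algebraMap k F (M 1 1)) * h4)
  have key : M = ((N.det)⁻¹ * (N 1 1 * M 0 0 - N 0 1 * M 1 0)) • N := by
    rw [mul_smul, eq_inv_smul_iff₀ hd, Matrix.det_fin_two]
    ext i j
    fin_cases i <;> fin_cases j <;> simp
    · linear_combination (-N 0 1) * e2
    · linear_combination (N 0 0) * e0 - (N 0 1) * e1
    · linear_combination (-N 1 1) * e2
    · linear_combination (N 1 0) * e0 - (N 1 1) * e1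
  refine ⟨_, fun h0 => ?_, key⟩
  rw [h0, zero_smul] at key
  exact h1 (by simp [key])

end IsMobius

theorem RatFunc.algEquiv_ext {τ σ : RatFunc k ≃ₐ[k] RatFunc k}
    (h : τ RatFunc.X = σ RatFunc.X) : τ = σ := by
  have : τ.toAlgHom = σ.toAlgHom := by
    apply IsLocalization.algHom_ext (nonZeroDivisors (Polynomial k))
    apply Polynomial.algHom_ext
    change τ (algebraMap (Polynomial k) (RatFunc k) Polynomial.X) =
      σ (algebraMap (Polynomial k) (RatFunc k) Polynomial.X)
    rwa [RatFunc.algebraMap_X]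
  ext x
  exact DFunLike.congr_fun this x

/-- The image of `X` generates `k(X)`, and the degree of `k(X)` over `k(y)` is the larger of the
degrees of numerator and denominator, so both are at most one. -/
theorem RatFunc.exists_isMobius (τ : RatFunc k ≃ₐ[k] RatFunc k) :
    ∃ M : Matrix (Fin 2) (Fin 2) k, IsMobius M (RatFunc.X : RatFunc k) (τ RatFunc.X) := by
  set y := τ RatFunc.X with hy
  have htop : IntermediateField.adjoin k {y} = ⊤ := by
    have h1 := IntermediateField.adjoin_map k {(RatFunc.X : RatFunc k)} τ.toAlgHom
    rw [RatFunc.adjoin_X, Set.image_singleton] at h1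
    rw [hy]
    refine h1.symm.trans ?_
    rw [← AlgHom.fieldRange_eq_map, AlgHom.fieldRange_eq_top]
    exact τ.surjective
  have hdeg := RatFunc.finrank_eq_max_natDegree y
  rw [htop, IntermediateField.finrank_top] at hdeg
  have hn := Polynomial.eq_X_add_C_of_natDegree_le_one
    (show y.num.natDegree ≤ 1 by rw [hdeg]; exact le_max_left _ _)
  have hd := Polynomial.eq_X_add_C_of_natDegree_le_one
    (show y.denom.natDegree ≤ 1 by rw [hdeg]; exact le_max_right _ _)
  have hn' := congrArg (algebraMap (Polynomial k) (RatFunc k)) hn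
  have hd' := congrArg (algebraMap (Polynomial k) (RatFunc k)) hd
  simp only [map_add, map_mul, RatFunc.algebraMap_X, RatFunc.algebraMap_C] at hn' hd'
  have h0 : algebraMap (Polynomial k) (RatFunc k) y.denom ≠ 0 :=
    RatFunc.algebraMap_ne_zero y.denom_ne_zero
  refine ⟨!![y.num.coeff 1, y.num.coeff 0; y.denom.coeff 1, y.denom.coeff 0], ?_, ?_⟩
  · simpa [RatFunc.algebraMap_eq_C, ← hd'] using y.denom_ne_zero
  · simp only [RatFunc.algebraMap_eq_C, Matrix.of_apply, Matrix.cons_val', Matrix.cons_val_zero,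
      Matrix.cons_val_fin_one, Matrix.cons_val_one]
    rw [← hd', ← hn']
    rw [eq_comm, ← eq_div_iff h0]
    exact (RatFunc.num_div_denom y).symm

/-- A group of automorphisms of `k(X)` has a faithful projective representation of dimension two. -/
theorem RatFunc.exists_isFaithfulProjective {G : Type*} [Group G]
    (τ : G →* (RatFunc k ≃ₐ[k] RatFunc k)) (hτ : Function.Injective τ) :
    ∃ M : G → Matrix (Fin 2) (Fin 2) k, IsFaithfulProjective M := by
  have hX : Transcendental k (RatFunc.X : RatFunc k) := RatFunc.transcendental_X
  have hX' : ∀ g, Transcendental k (τ g RatFunc.X) := fun g h =>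
    hX ((isAlgebraic_algHom_iff (τ g).toAlgHom (τ g).injective).mp h)
  -- Substitution reverses composition; the inverse restores the order of multiplication.
  choose M hM using fun g => RatFunc.exists_isMobius (τ g⁻¹)
  refine ⟨M, ⟨fun g h => ?_, ?_, ?_⟩⟩
  · have h1 := ((hM g).map (τ h⁻¹)).comp (hM h)
    rw [← AlgEquiv.mul_apply, ← map_mul, ← mul_inv_rev] at h1
    exact h1.exists_eq_smul (hM (g * h)) hX (hX' _)
  · have h1 := hM 1
    rw [inv_one, map_one, AlgEquiv.one_apply] at h1
    exact h1.exists_eq_smul (IsMobius.one _) hX hX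
  · rintro g ⟨c, hc⟩
    have h1 := (hc ▸ hM g).eq_of_smul_one
    have h2 : τ g⁻¹ = τ 1 := RatFunc.algEquiv_ext (by rw [h1, map_one, AlgEquiv.one_apply])
    exact inv_eq_one.mp (hτ h2)

end Mobius

/-! ### Faithful stable fields of transcendence degree one -/

section FaithfulStable

variable {k G : Type*} [Field k] [Group G]

/-- The restriction of an action to a stable subalgebra. -/
noncomputable def restrictAction {L : Type*} [CommRing L] [Algebra k L] (σ : G →* (L ≃ₐ[k] L))
    (R : Subalgebra k L) (hR : ∀ g, ∀ x ∈ R, σ g x ∈ R) : G →* (R ≃ₐ[k] R) :=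
  (AlgEquiv.algHomUnitsEquiv k R).toMonoidHom.comp
    (MonoidHom.toHomUnits
      { toFun := fun g => ((σ g).toAlgHom.comp R.val).codRestrict R fun x => hR g x x.2
        map_one' := by
          ext x
          simp
        map_mul' := fun g h => by
          ext x
          simp
          rfl })

@[simp]
theorem coe_restrictAction_apply {L : Type*} [CommRing L] [Algebra k L] (σ : G →* (L ≃ₐ[k] L))
    (R : Subalgebra k L) (hR : ∀ g, ∀ x ∈ R, σ g x ∈ R) (g : G) (x : R) :
    (restrictAction σ R hR g x : L) = σ g x := rfl

@[simp]
theorem fracAut_algebraMap {R : Type*} [CommRing R] [IsDomain R] [Algebra k R]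
    (f : R ≃ₐ[k] R) (x : R) :
    fracAut k R f (algebraMap R (FractionRing R) x) = algebraMap R (FractionRing R) (f x) :=
  IsFractionRing.algEquivOfAlgEquiv_algebraMap f x

theorem fracAut_injective {R : Type*} [CommRing R] [IsDomain R] [Algebra k R] :
    Function.Injective (fracAut k R) := by
  intro f h e
  ext x
  apply IsFractionRing.injective R (FractionRing R)
  rw [← fracAut_algebraMap, e, fracAut_algebraMap]

theorem adjoin_stable_of_stable {L : Type*} [CommRing L] [Algebra k L] (σ : G →* (L ≃ₐ[k] L))
    (s : Set L) (hs : ∀ g, ∀ x ∈ s, σ g x ∈ s) :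
    ∀ g, ∀ x ∈ Algebra.adjoin k s, σ g x ∈ Algebra.adjoin k s := by
  intro g x hx
  have : Algebra.adjoin k s ≤ (Algebra.adjoin k s).comap (σ g).toAlgHom :=
    Algebra.adjoin_le fun y hy => Algebra.subset_adjoin (hs g y hy)
  exact this hx

variable {A L : Type*} [CommRing A] [IsDomain A] [Algebra k A] [Field L] [Algebra k L] [Algebra A L]
  [IsScalarTower k A L] [IsFractionRing A L] {m : ℕ}

/-- A nontrivial group does not act faithfully on algebraic elements of a rational function
field. -/
theorem IsFaithfulStable.one_le_trdeg [Nontrivial G] (e : A ≃ₐ[k] MvPolynomial (Fin m) k)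
    {σ : G →* (L ≃ₐ[k] L)} {E : IntermediateField k L} (hE : IsFaithfulStable σ E) :
    1 ≤ Algebra.trdeg k E := by
  by_contra h
  have h0 : Algebra.trdeg k E = 0 := Cardinal.lt_one_iff.mp (not_le.mp h)
  have halg : Algebra.IsAlgebraic k E := trdeg_eq_zero_iff.mp h0
  obtain ⟨g, hg⟩ := exists_ne (1 : G)
  refine hg (hE.2 g fun x hx => ?_)
  obtain ⟨c, rfl⟩ := e.mem_range_algebraMap_of_isAlgebraic x
    ((isAlgebraic_algHom_iff E.val Subtype.val_injective).mpr (halg.isAlgebraic ⟨x, hx⟩))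
  exact (σ g).commutes c

/-- A finite group that acts faithfully on a field of transcendence degree one inside a rational
function field acts faithfully on `k(X)`. -/
theorem IsFaithfulStable.exists_ratFunc_action [Finite G] [Nontrivial G]
    (e : A ≃ₐ[k] MvPolynomial (Fin m) k) {σ : G →* (L ≃ₐ[k] L)} {E : IntermediateField k L}
    (hE : IsFaithfulStable σ E) (htr : Algebra.trdeg k E ≤ 1) :
    ∃ τ : G →* (RatFunc k ≃ₐ[k] RatFunc k), Function.Injective τ := by
  have hx : ∀ g : G, ∃ x ∈ E, σ g x = x → g = 1 := by
    intro g
    by_contra! h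
    exact (h 0 E.zero_mem).2 (hE.2 g fun x hx => (h x hx).1)
  choose x hxE hx using hx
  let s : Set L := Set.range fun q : G × G => σ q.1 (x q.2)
  have hs : s.Finite := Set.finite_range _
  have hxs : ∀ g, x g ∈ s := fun g => ⟨(1, g), by simp⟩
  let R : Subalgebra k L := Algebra.adjoin k s
  have hR : ∀ g, ∀ y ∈ R, σ g y ∈ R := adjoin_stable_of_stable σ s (by
    rintro g _ ⟨⟨a, b⟩, rfl⟩
    exact ⟨(g * a, b), by simp⟩)
  have hRE : R ≤ E.toSubalgebra := Algebra.adjoin_le (by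
    rintro _ ⟨⟨a, b⟩, rfl⟩
    exact hE.1 a _ (hxE b))
  have hRfg : R.FG := Subalgebra.fg_def.mpr ⟨s, hs, rfl⟩
  have hRtr : Algebra.trdeg k R ≤ 1 :=
    (trdeg_le_of_injective (A' := E) (Subalgebra.inclusion hRE)
      (Subalgebra.inclusion_injective hRE)).trans htr
  let α := restrictAction σ R hR
  have hα : Function.Injective α := by
    rw [injective_iff_map_eq_one]
    intro g hg
    refine hx g ?_
    have h1 : α g ⟨x g, Algebra.subset_adjoin (hxs g)⟩ = ⟨x g, Algebra.subset_adjoin (hxs g)⟩ := by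
      rw [hg]
      rfl
    exact congrArg Subtype.val h1
  obtain ⟨g, hg⟩ := exists_ne (1 : G)
  obtain ⟨ψ, hψ⟩ := e.exists_algHom_ratFunc_transcendental hRfg
    ⟨x g, Algebra.subset_adjoin (hxs g)⟩ (by
      rintro ⟨c, hc⟩
      refine hg (hx g ?_)
      rw [← show algebraMap k L c = x g from hc]
      exact (σ g).commutes c)
  -- `ψ` need not be equivariant: it only identifies the fraction field of `R`, and the action is
  -- carried over along `ε`.
  obtain ⟨ε⟩ := nonempty_fractionRing_algEquiv_ratFunc ψ
    (AlgHom.injective_of_trdeg_le_one hRtr ψ _ hψ) _ hψ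
  exact ⟨(AlgEquiv.autCongr ε).toMonoidHom.comp ((fracAut k R).comp α),
    (AlgEquiv.autCongr ε).injective.comp (fracAut_injective.comp hα)⟩

end FaithfulStable

/-! ### Krull dimension and transcendence degree of finitely generated domains -/

section Dimension

/-- Lying over lifts the bottom prime of a chain, and going up lifts the rest. -/
theorem ringKrullDim_le_of_isIntegral (R S : Type*) [CommRing R] [CommRing S] [Algebra R S]
    [FaithfulSMul R S] [Algebra.IsIntegral R S] : ringKrullDim R ≤ ringKrullDim S := by
  refine iSup_le fun l => ?_
  obtain ⟨⟨P, hP, hPl⟩⟩ := (inferInstance : Nonempty (l.head.asIdeal.primesOver S))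
  obtain ⟨l', hl', -, -⟩ := Ideal.exists_ltSeries_of_hasGoingUp (R := R) (S := S) l P
  rw [← hl']
  exact le_iSup (fun q : LTSeries (PrimeSpectrum S) => (q.length : WithBot ℕ∞)) l'

theorem ringKrullDim_eq_of_isIntegral (R S : Type*) [CommRing R] [CommRing S] [Algebra R S]
    [FaithfulSMul R S] [Algebra.IsIntegral R S] : ringKrullDim S = ringKrullDim R := by
  refine le_antisymm ?_ (ringKrullDim_le_of_isIntegral R S)
  exact Order.krullDim_le_of_strictMono (PrimeSpectrum.comap (algebraMap R S)) fun P Q h =>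
    Ideal.IsIntegral.comap_lt_comap (R := R) h

/-- The Krull dimension of a finitely generated domain is its transcendence degree. -/
theorem exists_ringKrullDim_eq_trdeg (k R : Type*) [Field k] [CommRing R] [IsDomain R]
    [Algebra k R] [Algebra.FiniteType k R] :
    ∃ s : ℕ, ringKrullDim R = s ∧ Algebra.trdeg k R = s := by
  obtain ⟨s, g, hg, hint⟩ := exists_integral_inj_algHom_of_fg k R
  let : Algebra (MvPolynomial (Fin s) k) R := g.toRingHom.toAlgebra
  have : IsScalarTower k (MvPolynomial (Fin s) k) R := IsScalarTower.of_algHom g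
  have : FaithfulSMul (MvPolynomial (Fin s) k) R := (faithfulSMul_iff_algebraMap_injective _ _).mpr hg
  have : Algebra.IsIntegral (MvPolynomial (Fin s) k) R := ⟨hint⟩
  refine ⟨s, ?_, ?_⟩
  · rw [ringKrullDim_eq_of_isIntegral (MvPolynomial (Fin s) k) R,
      MvPolynomial.ringKrullDim_of_isNoetherianRing, ringKrullDim_eq_zero_of_field, zero_add,
      Nat.card_fin]
  · have htr := lift_trdeg_add_eq k (MvPolynomial (Fin s) k) R
    rw [trdeg_eq_zero (R := MvPolynomial (Fin s) k) (A := R), MvPolynomial.trdeg_of_isDomain] at htr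
    rw [← Cardinal.lift_inj, ← htr]
    simp

theorem IntermediateField.trdeg_adjoin_subalgebra {k L : Type*} [Field k] [Field L] [Algebra k L]
    (R : Subalgebra k L) :
    Algebra.trdeg k (IntermediateField.adjoin k (R : Set L)) = Algebra.trdeg k R := by
  let E := IntermediateField.adjoin k (R : Set L)
  have hRE : R ≤ E.toSubalgebra := IntermediateField.subset_adjoin k (R : Set L)
  let : Algebra R E := (Subalgebra.inclusion hRE).toRingHom.toAlgebra
  have : IsScalarTower k R E := IsScalarTower.of_algHom (Subalgebra.inclusion hRE)
  have : IsScalarTower R E L := IsScalarTower.of_algebraMap_eq fun _ => rfl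
  have hinj : Function.Injective (algebraMap R E) := Subalgebra.inclusion_injective hRE
  have : FaithfulSMul R E := (faithfulSMul_iff_algebraMap_injective _ _).mpr hinj
  have : FaithfulSMul k R := inferInstance
  have halg : Algebra.IsAlgebraic R E := by
    refine ⟨fun x => ?_⟩
    obtain ⟨x, hx⟩ := x
    obtain ⟨a, ha, b, hb, rfl⟩ := IntermediateField.mem_adjoin_iff_div.mp hx
    rw [Algebra.adjoin_eq] at ha hb
    have e : (⟨a / b, hx⟩ : E) = algebraMap R E ⟨a, ha⟩ / algebraMap R E ⟨b, hb⟩ := rfl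
    rw [e, div_eq_mul_inv]
    exact (isAlgebraic_algebraMap _).mul (isAlgebraic_algebraMap _).inv
  have h := trdeg_add_eq k R (A := E)
  rw [trdeg_eq_zero (R := R) (A := E), add_zero] at h
  exact h.symm

end Dimension

/-! ### Trace-surjective algebras from actions -/

section Action

/-- The function is constant on left cosets of the subgroup generated by `z`, whose order is
divisible by `p`. -/
theorem sum_eq_zero_of_isPGroup {G L : Type*} [Group G] [Fintype G] [CommRing L] (p : ℕ)
    [Fact p.Prime] [CharP L p] (hG : IsPGroup p G) (f : G → L) {z : G} (hz : z ≠ 1)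
    (hf : ∀ g, f (g * z) = f g) : ∑ g, f g = 0 := by
  classical
  let Z := Subgroup.zpowers z
  have hfZ : ∀ g, ∀ y ∈ Z, f (g * y) = f g := by
    intro g y hy
    obtain ⟨n, rfl⟩ := Submonoid.mem_powers_iff _ _ |>.mp (mem_powers_iff_mem_zpowers.mpr hy)
    induction n with
    | zero => rw [pow_zero, mul_one]
    | succ n ih =>
      rw [pow_succ, ← mul_assoc, hf, ih (pow_mem (Subgroup.mem_zpowers z) n)]
  have : Nontrivial Z := ⟨1, ⟨z, Subgroup.mem_zpowers z⟩, fun h => hz (congrArg Subtype.val h).symm⟩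
  have hcard : (Nat.card Z : L) = 0 := by
    obtain ⟨n, hn0, hn⟩ := (hG.to_subgroup Z).nontrivial_iff_card.mp this
    rw [hn, Nat.cast_pow, CharP.cast_eq_zero, zero_pow hn0.ne']
  obtain ⟨S, hS, -⟩ := Z.exists_isComplement_left 1
  rw [← (Equiv.ofBijective _ hS).sum_comp, Fintype.sum_prod_type]
  refine Finset.sum_eq_zero fun q _ => ?_
  have hq : ∀ y : Z, f (Equiv.ofBijective _ hS (q, y)) = f q := fun y => hfZ q y y.2
  simp_rw [hq]
  rw [Finset.sum_const, Finset.card_univ, nsmul_eq_mul, ← Nat.card_eq_fintype_card]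
  exact mul_eq_zero_of_left hcard _

/-- A finite group of automorphisms of a field has an element of trace one. -/
theorem exists_trace_eq_one {k G L : Type*} [Field k] [Group G] [Fintype G] [Field L] [Algebra k L]
    (σ : G →* (L ≃ₐ[k] L)) (hσ : Function.Injective σ) : ∃ c : L, ∑ g, σ g c = 1 := by
  obtain ⟨a, ha⟩ : ∃ a : L, ∑ g, σ g a ≠ 0 := by
    by_contra! h
    -- Dedekind's independence of characters: the sum of distinct automorphisms is not zero.
    have hli := (linearIndependent_monoidHom L L).comp
      (fun g : G => ((σ g : L →ₐ[k] L) : L →* L)) (fun g h e => hσ (by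
        ext x
        exact DFunLike.congr_fun e x))
    have := Fintype.linearIndependent_iff.mp hli (fun _ => 1) (by
      ext x
      simpa using h x) 1
    exact one_ne_zero this
  have hfix : ∀ h, σ h (∑ g, σ g a) = ∑ g, σ g a := by
    intro h
    rw [map_sum]
    simp_rw [← AlgEquiv.mul_apply, ← map_mul]
    exact Equiv.sum_comp (Equiv.mulLeft h) fun g => σ g a
  refine ⟨a / ∑ g, σ g a, ?_⟩
  simp_rw [map_div₀, hfix]
  rw [← Finset.sum_div, div_self ha]

namespace TraceSurj

variable {k : Type u} [Field k] {G : Type v} [Group G] [Fintype G]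

/-- A finitely generated algebra with a group of automorphisms and an element of trace one. -/
def ofAction (A : Type u) [CommRing A] [Algebra k A] (hA : Algebra.FiniteType k A)
    (α : G →* (A ≃ₐ[k] A)) (hα : ∃ c : A, ∑ g, α g c = 1) : TraceSurj k G where
  carrier := A
  action := MulSemiringAction.compHom A α
  smulComm :=
    letI := MulSemiringAction.compHom A α
    ⟨fun g c x => map_smul (α g) c x⟩
  finiteType := hA
  trace_surjective b hb := by
    obtain ⟨c, hc⟩ := hα
    refine ⟨b * c, ?_⟩
    have h : ∀ g, α g (b * c) = b * α g c := fun g => by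
      rw [map_mul]
      exact congrArg (· * α g c) (hb g)
    calc ∑ g, α g (b * c) = b := by simp_rw [h]; rw [← Finset.mul_sum, hc, mul_one]

/-- An action with an element of trace one restricts to a trace-surjective finitely generated
subalgebra. -/
theorem exists_algHom {L : Type*} [CommRing L] [Algebra k L] (σ : G →* (L ≃ₐ[k] L))
    (hσ : ∃ c : L, ∑ g, σ g c = 1) :
    ∃ (A : TraceSurj k G) (φ : A →ₐ[k] L), ∀ (g : G) (a : A), φ (g • a) = σ g (φ a) := by
  obtain ⟨c, hc⟩ := hσ
  let s : Set L := Set.range fun g => σ g c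
  let R : Subalgebra k L := Algebra.adjoin k s
  have hR : ∀ g, ∀ y ∈ R, σ g y ∈ R := adjoin_stable_of_stable σ s (by
    rintro g _ ⟨a, rfl⟩
    exact ⟨g * a, by simp⟩)
  have hRfg : Algebra.FiniteType k R :=
    R.fg_iff_finiteType.mp (Subalgebra.fg_def.mpr ⟨s, Set.finite_range _, rfl⟩)
  obtain ⟨n, f, hf⟩ := Algebra.FiniteType.iff_quotient_mvPolynomial''.mp hRfg
  -- Objects live in the universe of `k`, while `L` may not; as a quotient of a polynomial ring, `R`
  -- has a copy there.
  have : Small.{u} R := small_of_surjective hf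
  let e : Shrink.{u} R ≃ₐ[k] R := Shrink.algEquiv k R
  let α := restrictAction σ R hR
  refine ⟨ofAction (Shrink.{u} R) (hRfg.equiv e.symm)
    ((AlgEquiv.autCongr e.symm).toMonoidHom.comp α)
    ⟨e.symm ⟨c, Algebra.subset_adjoin ⟨1, by simp⟩⟩, ?_⟩, R.val.comp e.toAlgHom, ?_⟩
  · apply e.injective
    apply Subtype.ext
    rw [map_sum, map_one e, AddSubmonoidClass.coe_finsetSum]
    refine Eq.trans (Finset.sum_congr rfl fun g _ => ?_) hc
    simp [α]
  · intro g a
    change ((e (e.symm (α g (e.symm.symm a))) : R) : L) = σ g (e a : R)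
    rw [e.apply_symm_apply]
    rfl

theorem exists_sum_smul_eq_one (B : TraceSurj k G) : ∃ b : B, ∑ g : G, g • b = 1 :=
  B.trace_surjective 1 fun g => smul_one g

/-- A universal algebra of Krull dimension at most one produces a faithful stable field of
transcendence degree at most one in each field with a faithful action. -/
theorem IsUniversal.exists_isFaithfulStable {B : TraceSurj k G} (hB : B.IsUniversal)
    (hdim : ringKrullDim B ≤ 1) (p : ℕ) [Fact p.Prime] [CharP k p] (hG : IsPGroup p G)
    {L : Type*} [Field L] [Algebra k L] (σ : G →* (L ≃ₐ[k] L)) (hσ : Function.Injective σ) :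
    ∃ E : IntermediateField k L, IsFaithfulStable σ E ∧ Algebra.trdeg k E ≤ 1 := by
  have : CharP L p := charP_of_injective_algebraMap (algebraMap k L).injective p
  obtain ⟨A, φ, hφ⟩ := exists_algHom σ (exists_trace_eq_one σ hσ)
  obtain ⟨f⟩ := hB A
  let θ : B →ₐ[k] L := φ.comp f.toAlgHom
  have hθ : ∀ (g : G) (b : B), θ (g • b) = σ g (θ b) := fun g b => by
    change φ (f.toAlgHom (g • b)) = _
    rw [f.map_smul, hφ]
    rfl
  let R := θ.range
  have hsurj : Function.Surjective θ.rangeRestrict := θ.rangeRestrict_surjective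
  have : Algebra.FiniteType k R := B.finiteType.of_surjective θ.rangeRestrict hsurj
  have hRdim : ringKrullDim R ≤ 1 :=
    (ringKrullDim_le_of_surjective θ.rangeRestrict.toRingHom hsurj).trans hdim
  refine ⟨IntermediateField.adjoin k (R : Set L), ⟨?_, ?_⟩, ?_⟩
  · intro g x hx
    have h1 : (IntermediateField.adjoin k (R : Set L)).map (σ g).toAlgHom ≤
        IntermediateField.adjoin k (R : Set L) := by
      rw [IntermediateField.adjoin_map]
      apply IntermediateField.adjoin.mono
      rintro _ ⟨_, ⟨b, rfl⟩, rfl⟩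
      exact ⟨g • b, hθ g b⟩
    exact h1 ⟨x, hx, rfl⟩
  · intro z hz
    by_contra hz1
    obtain ⟨b, hb⟩ := B.exists_sum_smul_eq_one
    have h1 : ∑ g, σ g (θ b) = 1 := by
      simp_rw [← hθ]
      rw [← map_sum, hb, map_one]
    -- If `z ≠ 1` fixed the image of `B`, the trace of `θ b` would be both one and zero.
    have h2 : ∑ g, σ g (θ b) = 0 := sum_eq_zero_of_isPGroup p hG _ hz1 fun g => by
      rw [map_mul, AlgEquiv.mul_apply,
        hz (θ b) (IntermediateField.subset_adjoin k _ ⟨b, rfl⟩)]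
    exact one_ne_zero (h1.symm.trans h2)
  · rw [IntermediateField.trdeg_adjoin_subalgebra]
    obtain ⟨s, h1, h2⟩ := exists_ringKrullDim_eq_trdeg k R
    rw [h1] at hRdim
    rw [h2]
    exact_mod_cast hRdim

end TraceSurj

end Action

/-! ### The basic algebra of a subgroup of the additive group -/

section AffineLine

open Polynomial

variable {k : Type u} [Field k] {G : Type v} [Group G]

/-- The translation action of `G` on `k[X]` given by a homomorphism to the additive group. -/
noncomputable def translationAction (l : G →* Multiplicative k) : G →* (k[X] ≃ₐ[k] k[X]) :=
  (AlgEquiv.algHomUnitsEquiv k k[X]).toMonoidHom.comp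
    (MonoidHom.toHomUnits
      { toFun := fun g => aeval (X + C (l g).toAdd)
        map_one' := by
          ext
          simp
        map_mul' := fun g h => by
          ext
          simp [add_comm, add_left_comm] })

@[simp]
theorem translationAction_apply (l : G →* Multiplicative k) (g : G) (P : k[X]) :
    translationAction l g P = aeval (X + C (l g).toAdd) P := rfl

/-- The Lagrange polynomial of degree `|G| - 1` that is one at `0` and zero at the other points of
`G` works: the sum of its translates has no larger degree and equals one at all `|G|` points. -/
theorem exists_sum_translationAction_eq_one [Fintype G] (l : G →* Multiplicative k)
    (hl : Function.Injective l) : ∃ P : k[X], ∑ g, translationAction l g P = 1 := by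
  classical
  let a : G → k := fun g => (l g).toAdd
  have ha : Function.Injective a := hl
  have ha1 : a 1 = 0 := by simp [a]
  have hamul : ∀ g h, a (g * h) = a g + a h := fun g h => by simp [a]
  let P : k[X] := Lagrange.basis Finset.univ a 1
  have hdeg : P.degree ≤ ((Fintype.card G - 1 : ℕ) : WithBot ℕ) := by
    rw [Lagrange.degree_basis ha.injOn (Finset.mem_univ _), Finset.card_univ]
  refine ⟨P, ?_⟩
  have hPeval : ∀ g, P.eval (a g) = if g = 1 then 1 else 0 := by
    intro g
    split_ifs with h
    · subst h
      exact Lagrange.eval_basis_self ha.injOn (Finset.mem_univ _)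
    · exact Lagrange.eval_basis_of_ne (Ne.symm h) (Finset.mem_univ _)
  refine Polynomial.eq_of_degrees_lt_of_eval_index_eq (s := Finset.univ) (v := a) ha.injOn ?_ ?_ ?_
  · have hcard : Fintype.card G - 1 < Fintype.card G := Nat.sub_lt Fintype.card_pos one_pos
    rw [Finset.card_univ]
    refine lt_of_le_of_lt ?_ (WithBot.coe_lt_coe.mpr hcard)
    refine (degree_sum_le _ _).trans (Finset.sup_le fun g _ => ?_)
    rw [translationAction_apply, ← comp_eq_aeval]
    refine (degree_le_natDegree).trans ?_
    refine WithBot.coe_le_coe.mpr ?_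
    rw [natDegree_comp, natDegree_X_add_C, mul_one]
    exact natDegree_le_of_degree_le hdeg
  · rw [degree_one, Finset.card_univ]
    exact_mod_cast Fintype.card_pos
  · intro h _
    rw [eval_finsetSum, eval_one]
    simp_rw [translationAction_apply, ← comp_eq_aeval, eval_comp, eval_add, eval_X, eval_C]
    have h1 : ∀ g, P.eval (a h + (l g).toAdd) = if g = h⁻¹ then 1 else 0 := by
      intro g
      change P.eval (a h + a g) = _
      rw [← hamul, hPeval]
      simp only [mul_eq_one_iff_inv_eq, eq_comm]
    simp_rw [h1]
    simp

namespace TraceSurj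

variable [Fintype G]

/-- The polynomial ring `k[X]` on which `G` acts by translations. -/
noncomputable def affineLine (l : G →* Multiplicative k) (hl : Function.Injective l) :
    TraceSurj k G :=
  ofAction k[X] inferInstance (translationAction l) (exists_sum_translationAction_eq_one l hl)

variable (l : G →* Multiplicative k) (hl : Function.Injective l)

theorem affineLine_isUniversal : (affineLine l hl).IsUniversal := by
  intro A
  obtain ⟨c, hc⟩ := A.exists_sum_smul_eq_one
  let a : G → k := fun g => (l g).toAdd
  have hamul : ∀ g h, a (g * h) = a g + a h := fun g h => by simp [a]
  -- Reindexing and `tr c = 1` give `g • y = y + a g`, the relation that `X` satisfies.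
  let y : A := -∑ h : G, a h • (h • c)
  have hy : ∀ g : G, g • y = y + algebraMap k A (a g) := by
    intro g
    have h1 : ∑ h : G, a (g * h) • ((g * h) • c) = ∑ h : G, a h • (h • c) :=
      Equiv.sum_comp (Equiv.mulLeft g) fun h => a h • (h • c)
    have h2 : ∑ h : G, ((g * h) • c) = 1 :=
      (Equiv.sum_comp (Equiv.mulLeft g) fun h => h • c).trans hc
    simp_rw [hamul, add_smul, Finset.sum_add_distrib, ← Finset.smul_sum, h2] at h1
    simp only [y]
    rw [smul_neg, Finset.smul_sum, ← h1, Algebra.algebraMap_eq_smul_one, neg_add]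
    simp_rw [smul_comm g, mul_smul]
    abel
  refine ⟨⟨(aeval y : k[X] →ₐ[k] A), fun g P => ?_⟩⟩
  change aeval y (translationAction l g P) = g • aeval y P
  have h3 : (aeval y : k[X] →ₐ[k] A).comp (translationAction l g).toAlgHom =
      (MulSemiringAction.toAlgHom k A g).comp (aeval y) := by
    ext
    simp only [AlgHom.comp_apply]
    change aeval y (translationAction l g X) = g • (aeval y X)
    rw [translationAction_apply, aeval_X, map_add, aeval_X, aeval_C, hy]
  exact DFunLike.congr_fun h3 P

/-- The image of `X` must be shifted by `l g` under `g`, so it is not constant, hence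
transcendental. -/
theorem affineLine_endomorphism_injective [Nontrivial G]
    (f : affineLine l hl ⟶ affineLine l hl) : Function.Injective f.toAlgHom := by
  let φ : k[X] →ₐ[k] k[X] := f.toAlgHom
  have hφ : ∀ g P, φ (translationAction l g P) = translationAction l g (φ P) := f.map_smul
  change Function.Injective φ
  have h1 : Transcendental k (φ X) := by
    by_contra h
    obtain ⟨c, hc⟩ : ∃ c, φ X = C c := by
      by_contra! hn
      have h2 : Transcendental k (algebraMap k[X] (RatFunc k) (φ X)) := by
        apply RatFunc.transcendental_of_ne_C
        rintro ⟨c, hc⟩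
        rw [← RatFunc.algebraMap_C] at hc
        exact hn c (IsFractionRing.injective k[X] (RatFunc k) hc)
      exact h fun h3 => h2 (h3.algHom (IsScalarTower.toAlgHom k k[X] (RatFunc k)))
    obtain ⟨g, hg⟩ := exists_ne (1 : G)
    have h2 := hφ g X
    rw [hc, translationAction_apply, translationAction_apply, aeval_X, aeval_C, map_add, hc] at h2
    have h3 : (C (l g).toAdd : k[X]) = 0 := by
      have h4 : φ (C (l g).toAdd) = C (l g).toAdd := φ.commutes _
      rw [h4] at h2
      exact add_eq_left.mp h2
    apply hg
    apply hl
    rw [map_one]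
    have h5 : (l g).toAdd = 0 := C_eq_zero.mp h3
    exact h5
  have h2 : φ = aeval (φ X) := by
    ext
    simp
  rw [h2]
  exact transcendental_iff_injective.mp h1

theorem mono_of_injective {A B : TraceSurj k G} (f : A ⟶ B) (hf : Function.Injective f.toAlgHom) :
    Mono f where
  right_cancellation a b h := by
    apply Hom.ext
    ext x
    exact hf (DFunLike.congr_fun (congrArg Hom.toAlgHom h) x)

/-- If `b` and `b'` have the same image, the orbits of `(b, b')` and `(c, c)` generate a subalgebra
of the fibre product. The trace-one element `(c, c)` makes it an object, and its two projections are
equalized by `f`. -/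
theorem injective_of_mono {A B : TraceSurj k G} (f : A ⟶ B) [Mono f] :
    Function.Injective f.toAlgHom := by
  intro b b' hbb
  obtain ⟨c, hc⟩ := A.exists_sum_smul_eq_one
  let σ : G →* ((A × A) ≃ₐ[k] (A × A)) :=
    { toFun := fun g => AlgEquiv.prodCongr (MulSemiringAction.toAlgAut G k A g)
        (MulSemiringAction.toAlgAut G k A g)
      map_one' := by
        ext x <;> simp
      map_mul' := fun g h => by
        ext x <;> simp }
  have hσ : ∀ g x, σ g x = (g • x.1, g • x.2) := fun _ _ => rfl
  let s : Set (A × A) := (Set.range fun g => σ g (b, b')) ∪ Set.range fun g => σ g (c, c)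
  let R : Subalgebra k (A × A) := Algebra.adjoin k s
  have hR : ∀ g, ∀ y ∈ R, σ g y ∈ R := adjoin_stable_of_stable σ s (by
    rintro g _ (⟨a, rfl⟩ | ⟨a, rfl⟩)
    · exact Or.inl ⟨g * a, by simp⟩
    · exact Or.inr ⟨g * a, by simp⟩)
  have hRfg : Algebra.FiniteType k R := R.fg_iff_finiteType.mp
    (Subalgebra.fg_def.mpr ⟨s, (Set.finite_range _).union (Set.finite_range _), rfl⟩)
  have hcR : (c, c) ∈ R := Algebra.subset_adjoin (Or.inr ⟨1, by simp⟩)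
  have hbR : (b, b') ∈ R := Algebra.subset_adjoin (Or.inl ⟨1, by simp⟩)
  have hRf : R ≤ AlgHom.equalizer (f.toAlgHom.comp (AlgHom.fst k A A))
      (f.toAlgHom.comp (AlgHom.snd k A A)) := by
    refine Algebra.adjoin_le ?_
    rintro _ (⟨a, rfl⟩ | ⟨a, rfl⟩)
    · change f.toAlgHom (a • b) = f.toAlgHom (a • b')
      rw [f.map_smul, f.map_smul, hbb]
    · rfl
  let D : TraceSurj k G := ofAction R hRfg (restrictAction σ R hR) ⟨⟨(c, c), hcR⟩, by
    apply Subtype.ext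
    rw [AddSubmonoidClass.coe_finsetSum]
    simp only [coe_restrictAction_apply, hσ]
    ext
    · simpa [Prod.fst_sum] using hc
    · simpa [Prod.snd_sum] using hc⟩
  let π₁ : D ⟶ A := ⟨(AlgHom.fst k A A).comp R.val, fun _ _ => rfl⟩
  let π₂ : D ⟶ A := ⟨(AlgHom.snd k A A).comp R.val, fun _ _ => rfl⟩
  have h : π₁ ≫ f = π₂ ≫ f := by
    apply Hom.ext
    ext x
    exact hRf x.2
  have h' : π₁ = π₂ := (cancel_mono f).mp h
  exact DFunLike.congr_fun (congrArg Hom.toAlgHom h') (⟨(b, b'), hbR⟩ : R)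

theorem prec_of_isUniversal [Nontrivial G] {A : TraceSurj k G} (h : Nonempty (A ⟶ affineLine l hl)) :
    Prec (affineLine l hl) A := by
  obtain ⟨f⟩ := h
  obtain ⟨e⟩ := affineLine_isUniversal l hl A
  refine ⟨e, mono_of_injective e ?_⟩
  have h1 := affineLine_endomorphism_injective l hl (e ≫ f)
  exact Function.Injective.of_comp (f := f.toAlgHom) h1

theorem affineLine_isBasic [Nontrivial G] : (affineLine l hl).IsBasic :=
  ⟨affineLine_isUniversal l hl, fun _ ⟨f, _⟩ => prec_of_isUniversal l hl ⟨f⟩⟩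

end TraceSurj

/-- A nontrivial finite group that embeds into the additive group of `k` has basic algebras, all of
Krull dimension one. -/
theorem basicDimEq_one [Fintype G] [Nontrivial G] (l : G →* Multiplicative k)
    (hl : Function.Injective l) : BasicDimEq k G 1 := by
  refine ⟨⟨_, TraceSurj.affineLine_isBasic l hl⟩, fun B hB => ?_⟩
  obtain ⟨e, he⟩ := TraceSurj.prec_of_isUniversal l hl (hB.1 (TraceSurj.affineLine l hl))
  -- Minimality of `B` reverses the embedding of `k[X]`, so the two transcendence degrees agree.
  obtain ⟨f, hf⟩ := hB.2 _ ⟨e, he⟩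
  have he' := TraceSurj.injective_of_mono e
  have hf' := TraceSurj.injective_of_mono f
  let φ : B →ₐ[k] k[X] := f.toAlgHom
  let ψ : k[X] →ₐ[k] B := e.toAlgHom
  have hφ : Function.Injective φ := hf'
  have : IsDomain B := hφ.isDomain (φ : B →+* k[X])
  have : Algebra.FiniteType k B := B.finiteType
  obtain ⟨s, h1, h2⟩ := exists_ringKrullDim_eq_trdeg k B
  have h3 := (trdeg_le_of_injective φ hf').antisymm (trdeg_le_of_injective ψ he')
  rw [h2, Polynomial.trdeg_of_isDomain] at h3
  rw [h1]
  exact_mod_cast h3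

end AffineLine

/-! ### The main theorem -/

section EssentialDimensionOne

variable {k G V : Type*} [Field k] [Group G] [AddCommGroup V] [Module k V]

theorem symAction_ι (ρ : Representation k G V) (g : G) (f : Module.Dual k V) :
    symAction ρ g (SymmetricAlgebra.ι k _ f) = SymmetricAlgebra.ι k _ (ρ.dual g f) :=
  SymmetricAlgebra.lift_ι_apply (SymmetricAlgebra.ι k _ ∘ₗ ρ.dual g) f

theorem symmetricAlgebra_ι_dual_injective :
    Function.Injective (SymmetricAlgebra.ι k (Module.Dual k V)) := by
  intro f h e
  ext v
  have := congrArg (SymmetricAlgebra.lift (Module.Dual.eval k V v)) e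
  simpa using this

theorem ratFunAction_injective (ρ : Representation k G V) (hρ : Function.Injective ρ) :
    Function.Injective (ratFunAction ρ) := by
  refine fracAut_injective.comp fun g h e => ?_
  have h1 : ∀ f : Module.Dual k V, ρ.dual g f = ρ.dual h f := fun f =>
    symmetricAlgebra_ι_dual_injective (by rw [← symAction_ι, e, symAction_ι])
  -- The dual action of `g` is precomposition with `ρ g⁻¹`.
  refine inv_injective (hρ ?_)
  ext v
  rw [← sub_eq_zero, ← Module.forall_dual_apply_eq_zero_iff k]
  intro f
  have h2 := DFunLike.congr_fun (h1 f) v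
  rw [map_sub, sub_eq_zero]
  exact h2

theorem fieldEssDim_eq_one {K : Type*} [Field K] [Algebra k K] {σ : G →* (K ≃ₐ[k] K)}
    (h1 : ∀ E, IsFaithfulStable σ E → 1 ≤ Algebra.trdeg k E)
    (h2 : ∃ E, IsFaithfulStable σ E ∧ Algebra.trdeg k E ≤ 1) : fieldEssDim σ = 1 := by
  obtain ⟨E, hE, hE1⟩ := h2
  have hmem : Algebra.trdeg k E ∈ {d | ∃ E : IntermediateField k K, IsFaithfulStable σ E ∧
      d = Algebra.trdeg k E} := ⟨E, hE, rfl⟩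
  refine le_antisymm ((csInf_le' hmem).trans hE1) (le_csInf ⟨_, hmem⟩ ?_)
  rintro _ ⟨F, hF, rfl⟩
  exact h1 F hF

theorem exists_isFaithfulStable_of_fieldEssDim_eq_one {K : Type*} [Field K] [Algebra k K]
    {σ : G →* (K ≃ₐ[k] K)} (h : fieldEssDim σ = 1) :
    ∃ E, IsFaithfulStable σ E ∧ Algebra.trdeg k E ≤ 1 := by
  -- The infimum of the empty set of cardinals is `0`, so the value `1` is attained.
  have hne : {d | ∃ E : IntermediateField k K, IsFaithfulStable σ E ∧ d = Algebra.trdeg k E}.Nonempty := by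
    by_contra hn
    rw [fieldEssDim, Set.not_nonempty_iff_eq_empty.mp hn, Cardinal.sInf_empty] at h
    exact zero_ne_one h
  obtain ⟨E, hE, hd⟩ := csInf_mem hne
  exact ⟨E, hE, (hd.symm.trans h).le⟩

end EssentialDimensionOne

theorem mainTheorem11 {k : Type*} [Field k] (p : ℕ) [Fact p.Prime] [CharP k p]
    {G : Type*} [Group G] [Fintype G] [Nontrivial G] (hG : IsPGroup p G)
    {V : Type*} [AddCommGroup V] [Module k V] [FiniteDimensional k V]
    (ρ : Representation k G V) (hρ : Function.Injective ρ) :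
    List.TFAE [
      BasicDimEq k G 1,
      essDim ρ = 1,
      ∃ n : ℕ, 1 ≤ n ∧ Nonempty (G ≃* Multiplicative (GaloisField p n)) ∧
        ∃ H : AddSubgroup k, Nonempty (G ≃* Multiplicative H),
      ∃ H : Subgroup (GL (Fin 2) k), Nonempty (G ≃* H)] := by
  let e : SymmetricAlgebra k (Module.Dual k V) ≃ₐ[k] MvPolynomial (Fin _) k :=
    SymmetricAlgebra.equivMvPolynomial (Module.finBasis k (Module.Dual k V))
  tfae_have 3 → 1 := by
    rintro ⟨-, -, -, H, ⟨f⟩⟩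
    exact basicDimEq_one ((AddMonoidHom.toMultiplicative H.subtype).comp f.toMonoidHom)
      (Subtype.val_injective.comp f.injective)
  tfae_have 1 → 2 := by
    rintro ⟨⟨B, hB⟩, hdim⟩
    exact fieldEssDim_eq_one (fun E hE => hE.one_le_trdeg e)
      (hB.1.exists_isFaithfulStable (hdim B hB).le p hG _ (ratFunAction_injective ρ hρ))
  tfae_have 2 → 3 := by
    intro h
    obtain ⟨E, hE, hE1⟩ := exists_isFaithfulStable_of_fieldEssDim_eq_one h
    obtain ⟨τ, hτ⟩ := hE.exists_ratFunc_action e hE1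
    obtain ⟨M, hM⟩ := RatFunc.exists_isFaithfulProjective τ hτ
    exact hM.elementary p hG
  tfae_have 3 → 4 := by
    rintro ⟨-, -, -, H, ⟨f⟩⟩
    exact exists_subgroup_GL_of_addSubgroup H f
  tfae_have 4 → 3 := by
    rintro ⟨H, ⟨f⟩⟩
    exact (isFaithfulProjective_of_mulEquiv p hG (H.subtype.comp f.toMonoidHom)
      (Subtype.val_injective.comp f.injective)).elementary p hG
  tfae_finish
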